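/- An inversion sequence of length $n$ is an integer sequence $(e_1,\dots,e_n)$ with $0\le e_i\le i-1$ for all $i$. Let $\mathbf I_n(110,102)$ be the set of inversion sequences $e$ of length $n$ that avoid the patterns $110$ and $102$, that is, for which there are no $i<j<k$ such that $e_ie_je_k$ is order isomorphic to $110$ (i.e. $e_i=e_j>e_k$) or to $102$ (i.e. $e_j<e_i<e_k$). For $0\le m<\ell\le n$ let $a_{n,m,\ell}$ be the number of $e\in\mathbf I_n(110,102)$ whose largest entry is $m$ and in which the left-most occurrence of $m$ is in position $\ell$, and let $$a(x;u,v)=\sum_{n\ge 2}\ \sum_{\ell=2}^{n}\ \sum_{m=1}^{\ell-1}a_{n,m,\ell}\,u^m v^\ell x^n .$$ Then, as formal power series in $x$ (where $\sqrt{1-4x}$ is the square root with constant term $1$), $$a(x;1,1)=\frac{x^2+x^2\sqrt{1-4x}}{(x-1)\left((3x-1)\sqrt{1-4x}-4x^2+5x-1\right)}.$$ Equivalently, for all $n\ge 1$, $$|\mathbf I_n(110,102)|=1+\sum_{i=1}^{n-1}\binom{2i}{i-1}.$$ -/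

import Mathlib

open PowerSeries

namespace InvSeq

/-- An inversion sequence `(e₁, …, eₙ)` with `0 ≤ eᵢ ≤ i - 1`.  With the 0-based index
`i : Fin n` (standing for position `i + 1`) the condition reads `e i ≤ i`. -/
def IsInversionSeq {n : ℕ} (e : Fin n → ℕ) : Prop :=
  ∀ i : Fin n, e i ≤ (i : ℕ)

/-- The word `w` contains the pattern `p`: some subword of `w` (entries at increasing, not
necessarily adjacent positions) is order isomorphic to `p`. Both words may have repeated letters. -/
def Contains {n k : ℕ} (w : Fin n → ℕ) (p : Fin k → ℕ) : Prop :=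
  ∃ f : Fin k → Fin n, StrictMono f ∧ ∀ i j : Fin k, w (f i) < w (f j) ↔ p i < p j

/-- The word `w` avoids the pattern `p`. -/
def Avoids {n k : ℕ} (w : Fin n → ℕ) (p : Fin k → ℕ) : Prop :=
  ¬ Contains w p

/-- The set `I_n(110, 102)` of `(110, 102)`-avoiding inversion sequences of length `n`. -/
def avoiders (n : ℕ) : Set (Fin n → ℕ) :=
  {e | IsInversionSeq e ∧ Avoids e ![1, 1, 0] ∧ Avoids e ![1, 0, 2]}

/-- The set `A_{n,m,ℓ}` of the `e ∈ I_n(110, 102)` whose largest entry is `m` and in which the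
left-most occurrence of `m` is in position `ℓ` (positions are numbered `1, …, n`). -/
def avoidersMaxPos (n m l : ℕ) : Set (Fin n → ℕ) :=
  {e | e ∈ avoiders n ∧ (∀ j, e j ≤ m) ∧
    ∃ i : Fin n, (i : ℕ) + 1 = l ∧ e i = m ∧ ∀ j < i, e j ≠ m}

/-- There are finitely many avoiders of each length, so that `Set.ncard` really counts them. -/
theorem finite_avoiders (n : ℕ) : (avoiders n).Finite := by
  refine (Set.Finite.pi' (t := fun i : Fin n => Set.Iic (i : ℕ))
    (fun i => Set.finite_Iic _)).subset ?_
  intro e he i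
  exact he.1 i

theorem finite_avoidersMaxPos (n m l : ℕ) : (avoidersMaxPos n m l).Finite :=
  (finite_avoiders n).subset fun _ he => he.1

/-- The number `a_{n,m,ℓ}` of elements of `A_{n,m,ℓ}`. -/
noncomputable def a (n m l : ℕ) : ℕ := (avoidersMaxPos n m l).ncard

/-- The polynomial `a_n(u, v) = ∑_{ℓ=2}^{n} ∑_{m=1}^{ℓ-1} a_{n,m,ℓ} u^m v^ℓ`, with variables
`u = X 0` and `v = X 1`. It is zero for `n < 2`. -/
noncomputable def aPoly (n : ℕ) : MvPolynomial (Fin 2) ℚ :=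
  ∑ l ∈ Finset.Icc 2 n, ∑ m ∈ Finset.Icc 1 (l - 1),
    MvPolynomial.C (a n m l : ℚ) * MvPolynomial.X 0 ^ m * MvPolynomial.X 1 ^ l

/-- The generating function `a(x; u, v) = ∑_{n ≥ 2} a_n(u, v) x^n`, a formal power series in `x`
whose coefficients are polynomials in `u` and `v`. -/
noncomputable def aGen : PowerSeries (MvPolynomial (Fin 2) ℚ) :=
  PowerSeries.mk fun n => if 2 ≤ n then aPoly n else 0

/-- The specialization `a(x; r, s)` of `a(x; u, v)` at rational numbers `u = r` and `v = s`. -/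
noncomputable def aGenEval (r s : ℚ) : PowerSeries ℚ :=
  PowerSeries.map (MvPolynomial.eval ![r, s]) aGen

/-- The formal power series `√(1 - 4x) = 1 - 2x ∑ₖ Cₖ xᵏ`, where `Cₖ` are the Catalan numbers. By
the lemmas below it is the unique square root of `1 - 4x` with constant term `1`. -/
noncomputable def sqrtOneSubFourX : PowerSeries ℚ :=
  1 - 2 * X * PowerSeries.map (Nat.castRingHom ℚ) catalanSeries

theorem sqrtOneSubFourX_sq : sqrtOneSubFourX ^ 2 = 1 - 4 * X := by
  have h := congrArg (PowerSeries.map (Nat.castRingHom ℚ)) catalanSeries_sq_mul_X_add_one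
  simp only [map_add, map_mul, map_pow, map_one, PowerSeries.map_X] at h
  unfold sqrtOneSubFourX
  linear_combination (4 * X) * h

theorem constantCoeff_sqrtOneSubFourX : constantCoeff sqrtOneSubFourX = 1 := by
  simp [sqrtOneSubFourX]

theorem eq_sqrtOneSubFourX (s : PowerSeries ℚ) (hs : s ^ 2 = 1 - 4 * X)
    (h1 : constantCoeff s = 1) : s = sqrtOneSubFourX := by
  rcases sq_eq_sq_iff_eq_or_eq_neg.mp (hs.trans sqrtOneSubFourX_sq.symm) with h | h
  · exact h
  · have h2 := congrArg constantCoeff h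
    rw [map_neg, h1, constantCoeff_sqrtOneSubFourX] at h2
    norm_num at h2

/-- The denominator `(x - 1)((3x - 1)√(1 - 4x) - 4x² + 5x - 1)` of the generating function has
constant term `2`, so it is invertible as a formal power series. -/
theorem constantCoeff_denominator :
    constantCoeff ((X - 1) * ((3 * X - 1) * sqrtOneSubFourX - 4 * X ^ 2 + 5 * X - 1) :
      PowerSeries ℚ) = 2 := by
  simp [constantCoeff_sqrtOneSubFourX]
  norm_num

end InvSeq

/-!
Read an avoiding sequence from left to right. By `snoc_mem_avoiders_iff`, the letter `x` may follow
a word exactly when `lo ≤ x ≤ hi` and `x` respects the bound by its position; here `lo` is the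
largest repeated letter (from `110`) and `hi` the smallest letter that exceeds a later one (from
`102`). Hence the number of continuations depends only on the set `S` of letters used, on `lo`,
`hi` and the length.

After the first descent `hi` is a letter `U`, and the bound by the position no longer matters. If
`d` is the letter of `S` just below `U`, and `g` values lie strictly between them, the generating
function (in `x`, by the number of letters appended) of the continuations below `U` is
`α_g + b_g P`, where `P` is that of the continuations below `d` (`desc_gap`). Splitting the gap at
the first letter gives, for `B(z) = ∑ b_g z^g` and `A(z) = ∑ α_g z^g`, a quadratic equation for
`B` and a linear one for `A`.

Before the first descent the word is weakly increasing with last letter `M`, and the continuations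
are counted by `A_s + B_s P`, where the slack `s` is the amount by which `M` falls short of the
bound at its position, and `P` is as before, with upper bound `M` (`series_eq_rise`). A repetition
of `M` raises the slack by one and forgets the past, whence a functional equation with kernel `1 - x
/ (z (1 - z))`. The kernel vanishes at `z = c = x C(x)`, with `C` the Catalan series. The value of
`B` at `c` involves a further square root, but it only enters through the product of the two
denominators `1 - x B` and `1 - c - x c B`, which equals `1 - 2c = √(1 - 4x)`. The result
(`flat_zero_mul`, `avoidersGF_sub_geom_mul`) is that the generating function of all avoiders is `1 /
(1 - x) + c² / ((1 - x) √(1 - 4x))`. The substitution `z = c` is carried out in the quotient of the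
ring of power series in `z` by `z - c`, into which the constants embed (`eq_zero_of_X_sub_C_dvd`).

The first summand accounts for the zero words, which are exactly those missing from `a(x; 1, 1)`
(for lengths `0` and `1` there is no other word), and
`c² / √(1 - 4x) = x ∑ (2i choose i - 1) x^i` gives the binomial sum.
-/

namespace InvSeq

/-! ### The two patterns -/

theorem contains_three_iff {n : ℕ} (w : Fin n → ℕ) (p : Fin 3 → ℕ) :
    Contains w p ↔ ∃ i j k : Fin n, i < j ∧ j < k ∧
      ∀ s t : Fin 3, w (![i, j, k] s) < w (![i, j, k] t) ↔ p s < p t := by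
  constructor
  · rintro ⟨f, hf, h⟩
    refine ⟨f 0, f 1, f 2, hf (by decide), hf (by decide), ?_⟩
    have : ![f 0, f 1, f 2] = f := by
      funext s
      fin_cases s <;> rfl
    rwa [this]
  · rintro ⟨i, j, k, hij, hjk, h⟩
    refine ⟨![i, j, k], ?_, h⟩
    rw [Fin.strictMono_iff_lt_succ]
    intro s
    fin_cases s
    · exact hij
    · exact hjk

theorem avoids_110_iff {n : ℕ} (e : Fin n → ℕ) :
    Avoids e ![1, 1, 0] ↔ ∀ i j k : Fin n, i < j → j < k → e i = e j → e i ≤ e k := by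
  rw [Avoids, contains_three_iff]
  push Not
  refine forall₃_congr fun i j k => forall₂_congr fun _ _ => ?_
  simp only [Fin.exists_fin_succ]
  simp
  omega

theorem avoids_102_iff {n : ℕ} (e : Fin n → ℕ) :
    Avoids e ![1, 0, 2] ↔ ∀ i j k : Fin n, i < j → j < k → e j < e i → e k ≤ e i := by
  rw [Avoids, contains_three_iff]
  push Not
  refine forall₃_congr fun i j k => forall₂_congr fun _ _ => ?_
  simp only [Fin.exists_fin_succ]
  simp
  omega

theorem zero_mem_avoiders (n : ℕ) : (fun _ => 0) ∈ avoiders n :=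
  ⟨fun _ => Nat.zero_le _, (avoids_110_iff _).2 fun _ _ _ _ _ _ => le_rfl,
    (avoids_102_iff _).2 fun _ _ _ _ _ _ => le_rfl⟩

/-! ### The letters that may be appended -/

/-- The largest repeated letter of a word (`0` if no letter is repeated). Avoiding `110` means that
each letter is at least the value of `lo` on the prefix before it. -/
def lo {n : ℕ} (e : Fin n → ℕ) : ℕ :=
  (Finset.univ.filter fun p : Fin n × Fin n => p.1 < p.2 ∧ e p.1 = e p.2).sup fun p => e p.1

/-- The smallest letter of a word that is followed, at any distance, by a smaller one (`⊤` if the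
word is weakly increasing). Avoiding `102` means that each letter is at most the value of `hi` on
the prefix before it. -/
noncomputable def hi {n : ℕ} (e : Fin n → ℕ) : ℕ∞ :=
  (Finset.univ.filter fun p : Fin n × Fin n => p.1 < p.2 ∧ e p.2 < e p.1).inf fun p => (e p.1 : ℕ∞)

/-- The smallest element of `S` above `x`, or `⊤` if there is none. -/
noncomputable def nextAbove (S : Finset ℕ) (x : ℕ) : ℕ∞ := (S.filter (x < ·)).inf fun y => (y : ℕ∞)

theorem lo_le_iff {n : ℕ} (e : Fin n → ℕ) (x : ℕ) :
    lo e ≤ x ↔ ∀ i j, i < j → e i = e j → e i ≤ x := by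
  simp [lo, Finset.sup_le_iff]

theorem le_hi_iff {n : ℕ} (e : Fin n → ℕ) (x : ℕ∞) :
    x ≤ hi e ↔ ∀ i j, i < j → e j < e i → x ≤ e i := by
  simp [hi, Finset.le_inf_iff]

theorem le_nextAbove_iff (S : Finset ℕ) (x : ℕ) (c : ℕ∞) :
    c ≤ nextAbove S x ↔ ∀ y ∈ S, x < y → c ≤ y := by
  simp [nextAbove, Finset.le_inf_iff]

theorem lo_snoc {n : ℕ} (e : Fin n → ℕ) (x : ℕ) (h : lo e ≤ x) :
    lo (Fin.snoc e x : Fin (n + 1) → ℕ) = if x ∈ Finset.univ.image e then x else lo e := by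
  refine eq_of_forall_ge_iff fun c => ?_
  rw [lo_le_iff]
  simp only [Fin.forall_fin_succ', Fin.snoc_castSucc, Fin.snoc_last, Fin.castSucc_lt_castSucc_iff,
    Fin.castSucc_lt_last, lt_irrefl, forall_true_left,
    not_lt_of_ge (Fin.le_last _), false_imp_iff, implies_true, and_true, forall_and]
  rw [← lo_le_iff]
  split_ifs with hx
  · simp only [Finset.mem_image, Finset.mem_univ, true_and] at hx
    obtain ⟨i, rfl⟩ := hx
    refine ⟨fun hc => hc.2 i rfl, fun hc => ⟨h.trans hc, fun j hj => hj ▸ hc⟩⟩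
  · simp only [Finset.mem_image, Finset.mem_univ, true_and, not_exists] at hx
    exact ⟨fun hc => hc.1, fun hc => ⟨hc, fun j hj => absurd hj (hx j)⟩⟩

theorem hi_snoc {n : ℕ} (e : Fin n → ℕ) (x : ℕ) :
    hi (Fin.snoc e x : Fin (n + 1) → ℕ) = min (hi e) (nextAbove (Finset.univ.image e) x) := by
  refine eq_of_forall_le_iff fun c => ?_
  rw [le_hi_iff, le_min_iff, le_hi_iff, le_nextAbove_iff]
  simp only [Fin.forall_fin_succ', Fin.snoc_castSucc, Fin.snoc_last, Fin.castSucc_lt_castSucc_iff,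
    Fin.castSucc_lt_last, lt_irrefl, forall_true_left,
    not_lt_of_ge (Fin.le_last _), false_imp_iff, implies_true, and_true, forall_and]
  simp

theorem image_snoc {n : ℕ} (e : Fin n → ℕ) (x : ℕ) :
    Finset.univ.image (Fin.snoc e x : Fin (n + 1) → ℕ) = insert x (Finset.univ.image e) := by
  ext y
  simp [Fin.exists_fin_succ', or_comm, eq_comm]

theorem snoc_mem_avoiders_iff {n : ℕ} (e : Fin n → ℕ) (x : ℕ) :
    (Fin.snoc e x : Fin (n + 1) → ℕ) ∈ avoiders (n + 1) ↔
      e ∈ avoiders n ∧ x ≤ n ∧ lo e ≤ x ∧ (x : ℕ∞) ≤ hi e := by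
  rw [lo_le_iff, le_hi_iff]
  simp only [avoiders, Set.mem_ofPred_eq, avoids_110_iff, avoids_102_iff, IsInversionSeq]
  simp only [Fin.forall_fin_succ', Fin.snoc_castSucc, Fin.snoc_last, Fin.castSucc_lt_castSucc_iff,
    Fin.castSucc_lt_last, lt_irrefl, forall_true_left, Fin.val_castSucc, Fin.val_last,
    not_lt_of_ge (Fin.le_last _), false_imp_iff, implies_true, and_true, forall_and, Nat.cast_le]
  tauto

/-- The number of ways to append `k` letters to an avoiding inversion sequence of length `len` with
set of letters `S`, largest repeated letter `lo` and smallest letter `hi` that exceeds a later one: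
these data determine which letters may follow. -/
noncomputable def count : ℕ → Finset ℕ → ℕ → ℕ∞ → ℕ → ℕ
  | 0, _, _, _, _ => 1
  | k + 1, S, lo, hi, len =>
    ∑ x ∈ (Finset.range (len + 1)).filter (fun x => lo ≤ x ∧ (x : ℕ∞) ≤ hi),
      count k (insert x S) (if x ∈ S then x else lo) (min hi (nextAbove S x)) (len + 1)

theorem ncard_avoiders_add (n k : ℕ) :
    (avoiders (n + k)).ncard =
      ∑ e ∈ (finite_avoiders n).toFinset, count k (Finset.univ.image e) (lo e) (hi e) n := by
  induction k generalizing n with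
  | zero => simp [count, Set.ncard_eq_toFinset_card _ (finite_avoiders n)]
  | succ k ih =>
    rw [← Nat.add_assoc, Nat.add_right_comm, ih (n + 1)]
    simp only [count]
    rw [Finset.sum_sigma']
    refine Finset.sum_bij' (fun e _ => ⟨Fin.init e, e (Fin.last n)⟩)
      (fun p _ => Fin.snoc p.1 p.2) ?_ ?_ ?_ ?_ ?_
    · intro e he
      rw [Set.Finite.mem_toFinset, ← Fin.snoc_init_self e, snoc_mem_avoiders_iff] at he
      simpa [Nat.lt_succ_iff] using he
    · rintro ⟨e, x⟩ he
      rw [Set.Finite.mem_toFinset, snoc_mem_avoiders_iff]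
      simpa [Nat.lt_succ_iff] using he
    · intro e _
      exact Fin.snoc_init_self e
    · rintro ⟨e, x⟩ _
      simp
    · intro e he
      rw [Set.Finite.mem_toFinset, ← Fin.snoc_init_self e, snoc_mem_avoiders_iff] at he
      conv_lhs => rw [← Fin.snoc_init_self e]
      rw [image_snoc, hi_snoc, lo_snoc _ _ he.2.2.1]

theorem ncard_avoiders_succ (k : ℕ) : (avoiders (k + 1)).ncard = count k {0} 0 ⊤ 1 := by
  have h0 : (finite_avoiders 0).toFinset = {Fin.elim0} := by
    ext e
    simp only [Set.Finite.mem_toFinset, Finset.mem_singleton, Subsingleton.elim e Fin.elim0,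
      iff_true]
    exact Subsingleton.elim (fun _ => 0) Fin.elim0 ▸ zero_mem_avoiders 0
  have := ncard_avoiders_add 0 (k + 1)
  rw [Nat.zero_add, h0, Finset.sum_singleton] at this
  rw [this]
  simp [count, lo, hi, nextAbove]

/-- The count depends only on the part of `S` between `lo` and `hi`, up to translation. -/
theorem count_shift (k : ℕ) (S S' : Finset ℕ) (lo : ℕ) (hi : ℕ∞) (len t : ℕ)
    (h : ∀ y : ℕ, lo ≤ y → (y : ℕ∞) ≤ hi → (y ∈ S ↔ y + t ∈ S')) :
    count k S' (lo + t) (hi + t) (len + t) = count k S lo hi len := by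
  induction k generalizing S S' lo hi len with
  | zero => simp [count]
  | succ k ih =>
    simp only [count]
    symm
    refine Finset.sum_bij' (fun x _ => x + t) (fun x _ => x - t) ?_ ?_ ?_ ?_ ?_
    · intro x hx
      simp only [Finset.mem_filter, Finset.mem_range] at hx ⊢
      refine ⟨by omega, by omega, ?_⟩
      push_cast
      exact add_le_add_left hx.2.2 _
    · intro x hx
      simp only [Finset.mem_filter, Finset.mem_range] at hx ⊢
      refine ⟨by omega, by omega, ?_⟩
      push_cast
      exact tsub_le_iff_right.2 hx.2.2
    · intro x hx
      simp
    · intro x hx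
      simp only [Finset.mem_filter, Finset.mem_range] at hx
      omega
    · intro x hx
      simp only [Finset.mem_filter, Finset.mem_range] at hx
      obtain ⟨-, hlo, hhi⟩ := hx
      have hmem : x ∈ S ↔ x + t ∈ S' := h x hlo hhi
      have hnext : min (hi + t) (nextAbove S' (x + t)) = min hi (nextAbove S x) + t := by
        refine ENat.eq_of_forall_natCast_le_iff fun c => ?_
        rw [← tsub_le_iff_right, ← ENat.natCast_sub, le_min_iff, le_min_iff, le_nextAbove_iff,
          le_nextAbove_iff]
        simp only [Nat.cast_le]
        rw [ENat.natCast_sub, tsub_le_iff_right]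
        refine and_congr_right fun hc => ⟨fun H y hy hxy => ?_, fun H y hy hxy => ?_⟩
        · rcases le_or_gt (y : ℕ∞) hi with hyh | hyh
          · have := H (y + t) ((h y (by omega) hyh).1 hy) (by omega)
            omega
          · have := (tsub_le_iff_right.2 hc).trans hyh.le
            rwa [← ENat.natCast_sub, Nat.cast_le] at this
        · rcases le_or_gt ((y - t : ℕ) : ℕ∞) hi with hyh | hyh
          · have := H (y - t) ((h (y - t) (by omega) hyh).2 (by rwa [Nat.sub_add_cancel (by omega)]))
              (by omega)
            omega
          · have := (tsub_le_iff_right.2 hc).trans hyh.le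
            rw [← ENat.natCast_sub, Nat.cast_le] at this
            omega
      rw [hnext, show (if x + t ∈ S' then x + t else lo + t) = (if x ∈ S then x else lo) + t by
        simp only [hmem]; split_ifs <;> rfl, Nat.add_right_comm len t 1]
      symm
      apply ih
      intro y hy hy'
      rw [Finset.mem_insert, Finset.mem_insert, Nat.add_right_cancel_iff]
      refine or_congr_right (h y ?_ (hy'.trans (min_le_left _ _)))
      split_ifs at hy with hxS
      · omega
      · exact hy

theorem count_congr_len (k : ℕ) (S : Finset ℕ) (lo : ℕ) (hi : ℕ∞) (len len' : ℕ)
    (h : hi ≤ len) (h' : hi ≤ len') : count k S lo hi len = count k S lo hi len' := by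
  induction k generalizing S lo hi len len' with
  | zero => simp [count]
  | succ k ih =>
    simp only [count]
    refine Finset.sum_congr ?_ fun x _ => ih _ _ _ _ _ ?_ ?_
    · ext x
      simp only [Finset.mem_filter, Finset.mem_range]
      refine ⟨fun hx => ⟨?_, hx.2⟩, fun hx => ⟨?_, hx.2⟩⟩
      · exact Nat.lt_succ_iff.2 (Nat.cast_le.1 (hx.2.2.trans h'))
      · exact Nat.lt_succ_iff.2 (Nat.cast_le.1 (hx.2.2.trans h))
    · exact (min_le_left _ _).trans (h.trans (Nat.cast_le.2 (Nat.le_succ _)))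
    · exact (min_le_left _ _).trans (h'.trans (Nat.cast_le.2 (Nat.le_succ _)))

/-! ### Generating functions of continuations -/

/-- The generating function, by number of appended letters, of the counts `count`. -/
noncomputable def series (S : Finset ℕ) (lo : ℕ) (hi : ℕ∞) (len : ℕ) : PowerSeries ℚ :=
  PowerSeries.mk fun k => (count k S lo hi len : ℚ)

theorem series_eq (S : Finset ℕ) (lo : ℕ) (hi : ℕ∞) (len : ℕ) :
    series S lo hi len = 1 + X *
      ∑ x ∈ (Finset.range (len + 1)).filter (fun x => lo ≤ x ∧ (x : ℕ∞) ≤ hi),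
        series (insert x S) (if x ∈ S then x else lo) (min hi (nextAbove S x)) (len + 1) := by
  ext k
  cases k with
  | zero => simp [series, count]
  | succ k =>
    rw [map_add, coeff_succ_X_mul, map_sum]
    simp [series, count, coeff_one]

theorem series_congr_len {S : Finset ℕ} {lo : ℕ} {hi : ℕ∞} {len len' : ℕ}
    (h : hi ≤ len) (h' : hi ≤ len') : series S lo hi len = series S lo hi len' := by
  ext k
  simp only [series, coeff_mk, count_congr_len k S lo hi len len' h h']

/-- The generating function of the continuations of a word that already has a descent and whose
letters are henceforth confined to the interval from `lo` to `U`. -/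
noncomputable def desc (S : Finset ℕ) (lo U : ℕ) : PowerSeries ℚ := series S lo U U

theorem series_eq_desc (S : Finset ℕ) (lo U len : ℕ) (h : U ≤ len) :
    series S lo U len = desc S lo U :=
  series_congr_len (Nat.cast_le.2 h) le_rfl

theorem desc_congr (S S' : Finset ℕ) (lo U : ℕ) (h : ∀ y, lo ≤ y → y ≤ U → (y ∈ S ↔ y ∈ S')) :
    desc S lo U = desc S' lo U := by
  unfold desc series
  ext k
  simp only [coeff_mk]
  have := count_shift k S S' lo U U 0 (by simpa using h)
  simp only [Nat.cast_zero, add_zero] at this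
  rw [this]

theorem desc_eq (S : Finset ℕ) (lo U : ℕ) :
    desc S lo U = 1 + X * ∑ x ∈ Finset.Ico lo (U + 1),
      series (insert x S) (if x ∈ S then x else lo) (min U (nextAbove S x)) (U + 1) := by
  rw [desc, series_eq]
  have : (Finset.range (U + 1)).filter (fun x => lo ≤ x ∧ (x : ℕ∞) ≤ U) =
      Finset.Ico lo (U + 1) := by
    ext x
    simp only [Finset.mem_filter, Finset.mem_range, Finset.mem_Ico, Nat.cast_le]
    omega
  rw [this]

theorem nextAbove_eq {S : Finset ℕ} {x U : ℕ} (hU : U ∈ S) (hx : x < U)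
    (h : ∀ y ∈ S, x < y → U ≤ y) : nextAbove S x = U := by
  apply le_antisymm
  · exact (le_nextAbove_iff S x _).1 le_rfl U hU hx
  · rw [le_nextAbove_iff]
    exact fun y hy hxy => Nat.cast_le.2 (h y hy hxy)

theorem nextAbove_le {S : Finset ℕ} {x U : ℕ} (hU : U ∈ S) (hx : x < U) : nextAbove S x ≤ U :=
  (le_nextAbove_iff S x _).1 le_rfl U hU hx

theorem le_nextAbove (S : Finset ℕ) (x : ℕ) : (x : ℕ∞) ≤ nextAbove S x := by
  rw [le_nextAbove_iff]
  exact fun y _ h => Nat.cast_le.2 h.le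

theorem nextAbove_eq_top {S : Finset ℕ} {x : ℕ} (h : ∀ y ∈ S, y ≤ x) : nextAbove S x = ⊤ := by
  rw [← top_le_iff, le_nextAbove_iff]
  exact fun y hy hxy => absurd (h y hy) (not_le.2 hxy)

/-- The series `1 / (1 - x)`. -/
noncomputable def geom : PowerSeries ℚ := PowerSeries.mk 1

theorem geom_mul : geom * (1 - X) = 1 := PowerSeries.mk_one_mul_one_sub_eq_one ℚ

theorem eq_of_mul_one_sub_X {f g : PowerSeries ℚ} (h : f * (1 - X) = g * (1 - X)) : f = g := by
  have := congrArg (· * geom) h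
  simpa only [mul_assoc, mul_comm (1 - X) geom, geom_mul, mul_one] using this

theorem desc_self {S : Finset ℕ} {U : ℕ} (hU : U ∈ S) : desc S U U = geom := by
  apply eq_of_mul_one_sub_X
  have h := desc_eq S U U
  rw [Nat.Ico_succ_singleton, Finset.sum_singleton, if_pos hU, Finset.insert_eq_of_mem hU,
    min_eq_left (le_nextAbove S U), series_eq_desc _ _ _ _ (Nat.le_succ U)] at h
  rw [geom_mul]
  linear_combination h

/-! ### Words with a descent -/

/-- The coefficients `b_g` of the affine map `P ↦ α_g + b_g P` attached to a gap of `g` letters. -/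
noncomputable def gapSlope : ℕ → PowerSeries ℚ
  | g => 1 + X * ∑ i : Fin g, gapSlope i * gapSlope (g - 1 - i)

theorem gapSlope_eq (g : ℕ) :
    gapSlope g = 1 + X * ∑ i ∈ Finset.range g, gapSlope i * gapSlope (g - 1 - i) := by
  rw [gapSlope, Finset.sum_range]

/-- `1 - x` as a unit of the ring of power series in `x`. -/
noncomputable def oneSubX : (PowerSeries ℚ)ˣ :=
  ⟨1 - X, geom, by rw [mul_comm, geom_mul], geom_mul⟩

/-- The series `1 / (1 - z)`; the variable `z` of the outer power series ring marks the size of a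
gap, or the slack below the diagonal. -/
noncomputable def onesGF : PowerSeries (PowerSeries ℚ) := PowerSeries.mk 1

theorem onesGF_mul : onesGF * (1 - X) = 1 := PowerSeries.mk_one_mul_one_sub_eq_one _

theorem coeff_X_mul_mul {R : Type*} [CommSemiring R] (g : ℕ) (F G : PowerSeries R) :
    coeff g (X * (F * G)) = ∑ i ∈ Finset.range g, coeff i F * coeff (g - 1 - i) G := by
  cases g with
  | zero => simp
  | succ g =>
    rw [coeff_succ_X_mul, coeff_mul, Finset.Nat.sum_antidiagonal_eq_sum_range_succ
      (fun i j => coeff i F * coeff j G), Nat.add_sub_cancel]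

/-- The generating function `∑ b_g z^g` of the slopes. -/
noncomputable def slopeGF : PowerSeries (PowerSeries ℚ) := PowerSeries.mk gapSlope

theorem slopeGF_eq : slopeGF = onesGF + C X * (X * (slopeGF * slopeGF)) := by
  ext1 g
  rw [map_add, coeff_C_mul, coeff_X_mul_mul]
  simp only [slopeGF, onesGF, coeff_mk]
  exact gapSlope_eq g

/-- The generating function `∑ α_g z^g` of the intercepts of the maps `P ↦ α_g + b_g P`. -/
noncomputable def interceptGF : PowerSeries (PowerSeries ℚ) :=
  C X * C geom * slopeGF * invOfUnit (1 - C X - C X * (X * (slopeGF + onesGF))) oneSubX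

theorem interceptGF_eq :
    interceptGF * (1 - C X) =
      C X * C geom * slopeGF + C X * (X * (interceptGF * slopeGF) + X * (interceptGF * onesGF)) := by
  have h := mul_invOfUnit (1 - C X - C X * (X * (slopeGF + onesGF))) oneSubX
    (by simp [oneSubX])
  rw [interceptGF]
  linear_combination (C X * C geom * slopeGF) * h

/-- The coefficients `α_g` of the affine map `P ↦ α_g + b_g P` attached to a gap of `g` letters. -/
noncomputable def gapIntercept (g : ℕ) : PowerSeries ℚ := coeff g interceptGF

theorem gapIntercept_eq (g : ℕ) :
    gapIntercept g * (1 - X) = X * geom * gapSlope g + X * ∑ i ∈ Finset.range g,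
      (gapIntercept (g - 1 - i) + gapSlope (g - 1 - i) * gapIntercept i) := by
  have h := congrArg (coeff g) interceptGF_eq
  rw [← map_one C, ← map_sub, coeff_mul_C, map_add, ← map_mul, coeff_C_mul, coeff_C_mul, map_add,
    coeff_X_mul_mul, mul_comm interceptGF onesGF, coeff_X_mul_mul] at h
  rw [gapIntercept, h, Finset.sum_add_distrib, add_comm (∑ i ∈ Finset.range g, coeff i _ * _)]
  simp [slopeGF, onesGF, gapIntercept, mul_comm]

/-- Splitting off the top gap: if `d < U` are consecutive letters of `S`, then the continuations
below `U` are an affine function of those below `d`, depending only on the size of the gap. -/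
theorem desc_gap (g : ℕ) (S : Finset ℕ) (lo d : ℕ) (hlo : lo ≤ d) (hd : d ∈ S)
    (hU : d + g + 1 ∈ S) (hgap : ∀ y ∈ S, d < y → d + g + 1 ≤ y) :
    desc S lo (d + g + 1) = gapIntercept g + gapSlope g * desc S lo d := by
  induction g using Nat.strong_induction_on generalizing S lo d with
  | _ g ih =>
  -- A first letter strictly between `d` and `U` splits the gap into two smaller ones.
  have hmid : ∀ lo' ≤ d, ∀ i ∈ Finset.range g,
      series (insert (d + 1 + i) S) (if d + 1 + i ∈ S then d + 1 + i else lo')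
        (min ((d + g + 1 : ℕ) : ℕ∞) (nextAbove S (d + 1 + i))) (d + g + 1 + 1) =
      gapIntercept (g - 1 - i) + gapSlope (g - 1 - i) *
        (gapIntercept i + gapSlope i * desc S lo' d) := by
    intro lo' hlo' i hi
    rw [Finset.mem_range] at hi
    have hnot : d + 1 + i ∉ S := fun h => by
      have := hgap _ h (by omega)
      omega
    rw [if_neg hnot, nextAbove_eq hU (by omega) (fun y hy h => hgap y hy (by omega)), min_self,
      series_eq_desc _ _ _ _ (Nat.le_succ _)]
    have h1 := ih (g - 1 - i) (by omega) (insert (d + 1 + i) S) lo' (d + 1 + i) (by omega)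
      (Finset.mem_insert_self _ _)
      (by rw [show d + 1 + i + (g - 1 - i) + 1 = d + g + 1 by omega]
          exact Finset.mem_insert_of_mem hU)
      (by intro y hy hy'
          rcases Finset.mem_insert.1 hy with rfl | hy
          · omega
          · have := hgap y hy (by omega)
            omega)
    have h2 := ih i hi (insert (d + 1 + i) S) lo' d hlo' (Finset.mem_insert_of_mem hd)
      (by rw [show d + i + 1 = d + 1 + i by omega]
          exact Finset.mem_insert_self _ _)
      (by intro y hy hy'
          rcases Finset.mem_insert.1 hy with rfl | hy
          · omega
          · have := hgap y hy (by omega)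
            omega)
    rw [show d + 1 + i + (g - 1 - i) + 1 = d + g + 1 by omega] at h1
    rw [show d + i + 1 = d + 1 + i by omega] at h2
    rw [h1, h2, desc_congr (insert (d + 1 + i) S) S lo' d]
    intro y _ hy
    rw [Finset.mem_insert, or_iff_right (by omega)]
  -- The first letter `U` is then repeated, and only `U` can follow.
  have htop : ∀ lo' : ℕ, series (insert (d + g + 1) S) (if d + g + 1 ∈ S then d + g + 1 else lo')
      (min ((d + g + 1 : ℕ) : ℕ∞) (nextAbove S (d + g + 1))) (d + g + 1 + 1) = geom := by
    intro lo'
    rw [if_pos hU, Finset.insert_eq_of_mem hU, min_eq_left (le_nextAbove S _),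
      series_eq_desc _ _ _ _ (Nat.le_succ _), desc_self hU]
  have hmidsum : ∀ lo' ≤ d, ∑ x ∈ Finset.Ico (d + 1) (d + g + 1),
      series (insert x S) (if x ∈ S then x else lo')
        (min ((d + g + 1 : ℕ) : ℕ∞) (nextAbove S x)) (d + g + 1 + 1) =
      ∑ i ∈ Finset.range g, (gapIntercept (g - 1 - i) + gapSlope (g - 1 - i) *
        (gapIntercept i + gapSlope i * desc S lo' d)) := by
    intro lo' hlo'
    rw [Finset.sum_Ico_eq_sum_range, show d + g + 1 - (d + 1) = g by omega]
    exact Finset.sum_congr rfl (hmid lo' hlo')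
  have hsum : ∀ P : PowerSeries ℚ, X * ∑ i ∈ Finset.range g,
      (gapIntercept (g - 1 - i) + gapSlope (g - 1 - i) * (gapIntercept i + gapSlope i * P)) =
      gapIntercept g * (1 - X) - X * geom * gapSlope g + (gapSlope g - 1) * P := by
    intro P
    have hb : gapSlope g - 1 = X * ∑ i ∈ Finset.range g, gapSlope i * gapSlope (g - 1 - i) := by
      linear_combination gapSlope_eq g
    rw [gapIntercept_eq, add_sub_cancel_left, hb, mul_assoc, ← mul_add, Finset.sum_mul,
      ← Finset.sum_add_distrib]
    exact congrArg _ (Finset.sum_congr rfl fun i _ => by ring)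
  -- The first letter `d` is then repeated: the gap between `d` and `U` is all that is left.
  have hbot : ∀ lo' : ℕ, series (insert d S) (if d ∈ S then d else lo')
      (min ((d + g + 1 : ℕ) : ℕ∞) (nextAbove S d)) (d + g + 1 + 1) = desc S d (d + g + 1) := by
    intro lo'
    rw [if_pos hd, Finset.insert_eq_of_mem hd, nextAbove_eq hU (by omega) hgap, min_self,
      series_eq_desc _ _ _ _ (Nat.le_succ _)]
  have hV : desc S d (d + g + 1) = gapIntercept g + gapSlope g * geom := by
    apply eq_of_mul_one_sub_X
    have h := desc_eq S d (d + g + 1)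
    rw [Finset.sum_Ico_succ_top (by omega),
      Finset.sum_eq_sum_Ico_succ_bot (show d < d + g + 1 by omega), htop, hbot,
      hmidsum d le_rfl, desc_self hd, mul_add, mul_add, hsum] at h
    linear_combination h - geom_mul
  -- First letters below `d` lead to the same states whether the upper bound is `U` or `d`.
  have h1 := desc_eq S lo (d + g + 1)
  have h2 := desc_eq S lo d
  rw [Finset.sum_Ico_succ_top (by omega), ← Finset.sum_Ico_consecutive _ hlo (by omega),
    Finset.sum_eq_sum_Ico_succ_bot (show d < d + g + 1 by omega), htop, hbot, hmidsum lo hlo,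
    mul_add, mul_add, mul_add, hsum, hV] at h1
  rw [Finset.sum_Ico_succ_top (by omega), if_pos hd, Finset.insert_eq_of_mem hd,
    min_eq_left (le_nextAbove S _), series_eq_desc _ _ _ _ (Nat.le_succ _), desc_self hd] at h2
  have h3 : ∑ x ∈ Finset.Ico lo d, series (insert x S) (if x ∈ S then x else lo)
        (min ((d + g + 1 : ℕ) : ℕ∞) (nextAbove S x)) (d + g + 1 + 1) =
      ∑ x ∈ Finset.Ico lo d, series (insert x S) (if x ∈ S then x else lo)
        (min (d : ℕ∞) (nextAbove S x)) (d + 1) := by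
    refine Finset.sum_congr rfl fun x hx => ?_
    rw [Finset.mem_Ico] at hx
    have hle : nextAbove S x ≤ d := nextAbove_le hd hx.2
    rw [min_eq_right hle, min_eq_right (hle.trans (Nat.cast_le.2 (by omega)))]
    exact series_congr_len (hle.trans (Nat.cast_le.2 (by omega)))
      (hle.trans (Nat.cast_le.2 (by omega)))
  rw [h3] at h1
  linear_combination h1 - h2

/-! ### Weakly increasing words -/

/-- The generating function of the continuations of a weakly increasing word whose last letter is
repeated and falls `s` short of the bound at its position: all such words behave like `0 ⋯ 0` of
length `s + 1`. -/
noncomputable def flat (s : ℕ) : PowerSeries ℚ := series {0} 0 ⊤ (s + 1)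

theorem series_repeated {S : Finset ℕ} {M : ℕ} (hM : M ∈ S) (hmax : ∀ y ∈ S, y ≤ M) (s : ℕ) :
    series S M ⊤ (M + s + 1) = flat s := by
  unfold flat series
  ext k
  simp only [coeff_mk]
  have h := count_shift k {0} S 0 ⊤ (s + 1) M (by
    intro y _ _
    rw [Finset.mem_singleton]
    refine ⟨?_, fun h => ?_⟩
    · rintro rfl
      rwa [Nat.zero_add]
    · have := hmax _ h
      omega)
  rw [Nat.zero_add, top_add, show s + 1 + M = M + s + 1 by omega] at h
  rw [h]

theorem gapSlope_zero : gapSlope 0 = 1 := by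
  rw [gapSlope_eq]
  simp

/-- The generating function `∑ B_s z^s`, where `A_s + B_s P` counts the continuations of a weakly
increasing word whose last letter `M` falls `s` short of the bound at its position, and
`P = desc S lo M`. -/
noncomputable def riseSlopeGF : PowerSeries (PowerSeries ℚ) :=
  onesGF * invOfUnit (1 - C X * slopeGF) oneSubX

theorem riseSlopeGF_eq : riseSlopeGF = onesGF + C X * (slopeGF * riseSlopeGF) := by
  have h := mul_invOfUnit (1 - C X * slopeGF) oneSubX (by
    simp [oneSubX, slopeGF, gapSlope_zero])
  rw [riseSlopeGF]
  linear_combination onesGF * h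

/-- The generating function `∑ A_s z^s` of the constant terms in `A_s + B_s P`, see
`riseSlopeGF`. -/
noncomputable def riseInterceptGF : PowerSeries (PowerSeries ℚ) :=
  (C X * PowerSeries.mk (fun s => flat (s + 1)) + C X * (interceptGF * riseSlopeGF) -
    C (X * geom) * onesGF) * invOfUnit (1 - C X * onesGF) oneSubX

theorem riseInterceptGF_eq :
    riseInterceptGF = C X * PowerSeries.mk (fun s => flat (s + 1)) +
      C X * (interceptGF * riseSlopeGF) - C (X * geom) * onesGF +
      C X * (onesGF * riseInterceptGF) := by
  have h := mul_invOfUnit (1 - C X * onesGF) oneSubX (by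
    simp [oneSubX, onesGF])
  rw [riseInterceptGF]
  linear_combination (C X * PowerSeries.mk (fun s => flat (s + 1)) +
    C X * (interceptGF * riseSlopeGF) - C (X * geom) * onesGF) * h

theorem coeff_mul_range {R : Type*} [CommSemiring R] (g : ℕ) (F G : PowerSeries R) :
    coeff g (F * G) = ∑ i ∈ Finset.range (g + 1), coeff i F * coeff (g - i) G := by
  rw [coeff_mul, Finset.Nat.sum_antidiagonal_eq_sum_range_succ
      (fun i j => coeff i F * coeff j G)]

theorem coeff_riseSlopeGF (s : ℕ) :
    coeff s riseSlopeGF =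
      1 + X * ∑ i ∈ Finset.range (s + 1), gapSlope i * coeff (s - i) riseSlopeGF := by
  conv_lhs => rw [riseSlopeGF_eq]
  rw [map_add, coeff_C_mul, coeff_mul_range]
  simp [onesGF, slopeGF]

theorem coeff_riseInterceptGF (s : ℕ) :
    coeff s riseInterceptGF = X * flat (s + 1) - X * geom +
      X * ∑ i ∈ Finset.range (s + 1),
        (coeff (s - i) riseInterceptGF + gapIntercept i * coeff (s - i) riseSlopeGF) := by
  conv_lhs => rw [riseInterceptGF_eq]
  rw [map_add, map_sub, map_add, coeff_C_mul, coeff_C_mul, coeff_C_mul, coeff_C_mul,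
    coeff_mul_range, coeff_mul_range, Finset.sum_add_distrib]
  simp only [onesGF, coeff_mk, Pi.one_apply, one_mul, mul_one, gapIntercept]
  ring

/-- The first-letter recursion for a weakly increasing word with last letter `M`. -/
theorem series_rise {S : Finset ℕ} {lo M : ℕ} (hM : M ∈ S) (hmax : ∀ y ∈ S, y ≤ M) (hlo : lo ≤ M)
    (s : ℕ) :
    series S lo ⊤ (M + s + 1) = desc S lo M - X * geom + X * flat (s + 1) +
      X * ∑ i ∈ Finset.range (s + 1),
        series (insert (M + 1 + i) S) lo ⊤ (M + 1 + i + (s - i) + 1) := by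
  have h := series_eq S lo ⊤ (M + s + 1)
  have hset : (Finset.range (M + s + 1 + 1)).filter (fun x => lo ≤ x ∧ (x : ℕ∞) ≤ ⊤) =
      Finset.Ico lo (M + s + 2) := by
    ext x
    simp only [Finset.mem_filter, Finset.mem_range, Finset.mem_Ico, le_top, and_true]
    omega
  have hlow : ∑ x ∈ Finset.Ico lo M, series (insert x S) (if x ∈ S then x else lo)
        (min ⊤ (nextAbove S x)) (M + s + 1 + 1) =
      ∑ x ∈ Finset.Ico lo M, series (insert x S) (if x ∈ S then x else lo)
        (min (M : ℕ∞) (nextAbove S x)) (M + 1) := by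
    refine Finset.sum_congr rfl fun x hx => ?_
    rw [Finset.mem_Ico] at hx
    have hle : nextAbove S x ≤ M := nextAbove_le hM hx.2
    rw [min_eq_right hle, min_eq_right le_top]
    exact series_congr_len (hle.trans (Nat.cast_le.2 (by omega)))
      (hle.trans (Nat.cast_le.2 (by omega)))
  have hhigh : ∑ x ∈ Finset.Ico (M + 1) (M + s + 2), series (insert x S)
        (if x ∈ S then x else lo) (min ⊤ (nextAbove S x)) (M + s + 1 + 1) =
      ∑ i ∈ Finset.range (s + 1),
        series (insert (M + 1 + i) S) lo ⊤ (M + 1 + i + (s - i) + 1) := by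
    rw [Finset.sum_Ico_eq_sum_range, show M + s + 2 - (M + 1) = s + 1 by omega]
    refine Finset.sum_congr rfl fun i hi => ?_
    rw [Finset.mem_range] at hi
    rw [if_neg fun hmem => by have := hmax _ hmem; omega,
      nextAbove_eq_top fun y hy => (hmax y hy).trans (by omega), min_self,
      show M + 1 + i + (s - i) + 1 = M + s + 1 + 1 by omega]
  have h2 := desc_eq S lo M
  rw [Finset.sum_Ico_succ_top hlo, if_pos hM, Finset.insert_eq_of_mem hM,
    min_eq_left (le_nextAbove S _), series_eq_desc _ _ _ _ (Nat.le_succ _), desc_self hM] at h2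
  rw [hset, ← Finset.sum_Ico_consecutive _ hlo (show M ≤ M + s + 2 by omega),
    Finset.sum_eq_sum_Ico_succ_bot (show M < M + s + 2 by omega), hlow, hhigh, if_pos hM,
    Finset.insert_eq_of_mem hM, nextAbove_eq_top hmax, min_self,
    show M + s + 1 + 1 = M + (s + 1) + 1 by omega, series_repeated hM hmax] at h
  linear_combination h - h2

/-- The number of continuations of a weakly increasing word is an affine function of the number
of continuations below its last letter. -/
theorem series_eq_rise {S : Finset ℕ} {lo M : ℕ} (hM : M ∈ S) (hmax : ∀ y ∈ S, y ≤ M)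
    (hlo : lo ≤ M) (s : ℕ) :
    series S lo ⊤ (M + s + 1) =
      coeff s riseInterceptGF + coeff s riseSlopeGF * desc S lo M := by
  -- Both sides satisfy the same recursion, in which every recursive term carries a factor `x`.
  have key : ∀ (k : ℕ) (s : ℕ) (S : Finset ℕ) (M : ℕ), M ∈ S → (∀ y ∈ S, y ≤ M) → lo ≤ M →
      (X : PowerSeries ℚ) ^ k ∣ series S lo ⊤ (M + s + 1) -
        (coeff s riseInterceptGF + coeff s riseSlopeGF * desc S lo M) := by
    intro k
    induction k with
    | zero => simp
    | succ k ih =>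
      intro s S M hM hmax hlo
      have hterm : ∀ i ∈ Finset.range (s + 1), (X : PowerSeries ℚ) ^ k ∣
          series (insert (M + 1 + i) S) lo ⊤ (M + 1 + i + (s - i) + 1) -
            (coeff (s - i) riseInterceptGF + coeff (s - i) riseSlopeGF *
              (gapIntercept i + gapSlope i * desc S lo M)) := by
        intro i _
        have h := ih (s - i) (insert (M + 1 + i) S) (M + 1 + i) (Finset.mem_insert_self _ _)
          (by intro y hy
              rcases Finset.mem_insert.1 hy with rfl | hy
              · exact le_rfl
              · exact (hmax y hy).trans (by omega))
          (by omega)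
        have hg := desc_gap i (insert (M + 1 + i) S) lo M hlo (Finset.mem_insert_of_mem hM)
          (by rw [show M + i + 1 = M + 1 + i by omega]
              exact Finset.mem_insert_self _ _)
          (by intro y hy hy'
              rcases Finset.mem_insert.1 hy with rfl | hy
              · omega
              · have := hmax y hy
                omega)
        rw [show M + i + 1 = M + 1 + i by omega] at hg
        rw [hg, desc_congr (insert (M + 1 + i) S) S lo M] at h
        · exact h
        · intro y _ hy
          rw [Finset.mem_insert, or_iff_right (by omega)]
      have hsum := Finset.dvd_sum hterm
      rw [Finset.sum_sub_distrib] at hsum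
      rw [pow_succ']
      convert mul_dvd_mul_left X hsum using 1
      rw [series_rise hM hmax hlo, coeff_riseInterceptGF, coeff_riseSlopeGF, mul_sub]
      have e : ∑ i ∈ Finset.range (s + 1), (coeff (s - i) riseInterceptGF +
          coeff (s - i) riseSlopeGF * (gapIntercept i + gapSlope i * desc S lo M)) =
        ∑ i ∈ Finset.range (s + 1),
          (coeff (s - i) riseInterceptGF + gapIntercept i * coeff (s - i) riseSlopeGF) +
        (∑ i ∈ Finset.range (s + 1), gapSlope i * coeff (s - i) riseSlopeGF) * desc S lo M := by
        rw [Finset.sum_mul, ← Finset.sum_add_distrib]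
        exact Finset.sum_congr rfl fun i _ => by ring
      rw [e]
      ring
  rw [← sub_eq_zero]
  ext k
  exact X_pow_dvd_iff.1 (key (k + 1) s S M hM hmax hlo) k (Nat.lt_succ_self k)

theorem flat_eq :
    riseInterceptGF + C geom * riseSlopeGF =
      C (flat 0) + X * PowerSeries.mk (fun s => flat (s + 1)) := by
  have h : PowerSeries.mk flat = riseInterceptGF + C geom * riseSlopeGF := by
    ext1 s
    have := series_eq_rise (S := {0}) (lo := 0) (M := 0) (by simp) (by simp) le_rfl s
    rw [desc_self (by simp), Nat.zero_add] at this
    rw [coeff_mk, flat, this, map_add, coeff_C_mul, mul_comm geom]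
  rw [← h]
  ext1 s
  cases s with
  | zero => simp
  | succ s => simp [coeff_succ_X_mul]

/-! ### The kernel method -/

/-- The series `c = x C(x)`, where `C` is the generating function of the Catalan numbers. -/
noncomputable def catX : PowerSeries ℚ := X * PowerSeries.map (Nat.castRingHom ℚ) catalanSeries

theorem sqrtOneSubFourX_eq : sqrtOneSubFourX = 1 - 2 * catX := by
  rw [sqrtOneSubFourX, catX, mul_assoc]

theorem catX_sub_sq : catX - catX ^ 2 = X := by
  have h := sqrtOneSubFourX_sq
  rw [sqrtOneSubFourX_eq] at h
  have h4 : (4 : PowerSeries ℚ) ≠ 0 := by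
    intro h0
    have := congrArg constantCoeff h0
    rw [map_ofNat, map_zero] at this
    norm_num at this
  apply mul_left_cancel₀ h4
  linear_combination -h

/-- Evaluation at `z = c` is faithful on constants in `z`. -/
theorem eq_zero_of_X_sub_C_dvd (r : PowerSeries ℚ)
    (h : (X : PowerSeries (PowerSeries ℚ)) - C catX ∣ C r) : r = 0 := by
  obtain ⟨G, hG⟩ := h
  have hs : ∀ s, r = -(catX ^ (s + 1) * coeff s G) := by
    intro s
    induction s with
    | zero =>
      have := congrArg (coeff 0) hG
      simpa [sub_mul] using this
    | succ s ih =>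
      have := congrArg (coeff (s + 1)) hG
      rw [sub_mul, map_sub, coeff_succ_X_mul, coeff_C_mul, coeff_C, if_neg (Nat.succ_ne_zero s)]
        at this
      rw [ih]
      linear_combination catX ^ (s + 1) * this
  ext k
  refine X_pow_dvd_iff.1 (?_ : (X : PowerSeries ℚ) ^ (k + 1) ∣ r) k (Nat.lt_succ_self k)
  rw [hs k, dvd_neg, catX, mul_pow, mul_assoc]
  exact dvd_mul_right _ _

/-- The kernel method: the coefficient `1 - x / (z (1 - z))` of `riseInterceptGF` vanishes at
`z = c`, and the value of the remaining terms there determines `flat 0`. -/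
theorem flat_zero_mul :
    flat 0 * (1 - 2 * catX) * (1 - catX) = geom * ((1 - catX) - catX * (1 - 2 * catX)) := by
  rw [← sub_eq_zero]
  apply mul_left_cancel₀ (X_ne_zero (R := ℚ))
  rw [mul_zero]
  apply eq_zero_of_X_sub_C_dvd
  rw [← Ideal.mem_span_singleton, ← Ideal.Quotient.eq_zero_iff_mem]
  set π := Ideal.Quotient.mk (Ideal.span {(X : PowerSeries (PowerSeries ℚ)) - C catX})
  -- In the quotient by `z - c`, the functional equations become equations without `z`.
  have hz : π X = π (C catX) := by
    rw [← sub_eq_zero, ← map_sub, Ideal.Quotient.eq_zero_iff_mem]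
    exact Ideal.mem_span_singleton_self _
  have hc := congrArg (fun f => π (C f)) catX_sub_sq
  have hE := congrArg π onesGF_mul
  have hB := congrArg π slopeGF_eq
  have hA := congrArg π interceptGF_eq
  have hY := congrArg π riseSlopeGF_eq
  have hI := congrArg π riseInterceptGF_eq
  have hF := congrArg π flat_eq
  simp only [map_add, map_sub, map_mul, map_one, map_pow, hz] at hc hE hB hA hY hI hF
  simp only [map_sub, map_mul, map_one, map_ofNat]
  generalize π (C catX) = c at *
  generalize π (C X) = x at *
  generalize π (C geom) = w at *
  generalize π onesGF = e at *
  generalize π slopeGF = β at *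
  generalize π interceptGF = a at *
  generalize π riseSlopeGF = y at *
  generalize π riseInterceptGF = ξ at *
  generalize π (PowerSeries.mk _) = l at *
  generalize π (C (flat 0)) = L at *
  have hxe : x * e = c := by linear_combination c * hE - e * hc
  -- The equation of `riseInterceptGF` times `c`: since `c (1 - x e) = c - c ^ 2 = x`, the unknown
  -- `ξ` cancels.
  have h1 : x * (L - w * y + c * w * e - c * a * y) = 0 := by
    linear_combination c * hI - x * hF + c * ξ * hxe - ξ * hc
  -- The denominators of `y` and `a` contain a second-level square root through `β`; their product
  -- does not.
  have hprod : (1 - x * β) * (1 - c - x * c * β) = 1 - 2 * c := by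
    linear_combination (-x) * hB - hxe
  have ha : a * (1 - c - x * c * β) = x * w * β := by
    linear_combination hA + a * c * hxe - a * hc
  have hy : y * (1 - 2 * c) = e * (1 - c - x * c * β) := by
    linear_combination (1 - c - x * c * β) * hY - y * hprod
  have hay : a * y * (1 - 2 * c) = c * w * β := by
    linear_combination a * hy + e * ha + w * β * hxe
  linear_combination (1 - 2 * c) * (1 - c) * h1 + x * w * (1 - c) * hy +
    x * (1 - c) * c * hay + x * w * (1 - c - c * (1 - 2 * c)) * hE - x * (1 - c) * w * c * β * hxe


/-- The generating function of the number of avoiders of each length. -/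
noncomputable def avoidersGF : PowerSeries ℚ := PowerSeries.mk fun n => ((avoiders n).ncard : ℚ)

theorem avoidersGF_eq : avoidersGF = 1 + X * flat 0 := by
  ext n
  cases n with
  | zero =>
    have h0 : avoiders 0 = Set.univ :=
      Set.eq_univ_of_forall fun e => Subsingleton.elim (fun _ => 0) e ▸ zero_mem_avoiders 0
    simp [avoidersGF, h0, Set.ncard_univ]
  | succ n =>
    rw [map_add, coeff_succ_X_mul]
    simp [avoidersGF, ncard_avoiders_succ, flat, series, coeff_one]

theorem avoidersGF_sub_geom_mul :
    (avoidersGF - geom) * (1 - X) * (1 - 2 * catX) = catX ^ 2 := by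
  have hc : (1 - catX : PowerSeries ℚ) ≠ 0 := by
    intro h
    have := congrArg constantCoeff h
    simp [catX] at this
  apply mul_right_cancel₀ hc
  rw [avoidersGF_eq]
  linear_combination X * (1 - X) * flat_zero_mul - (1 - 2 * catX) * (1 - catX) * geom_mul +
    X * ((1 - catX) - catX * (1 - 2 * catX)) * geom_mul - catX * catX_sub_sq

/-! ### Refinement by the largest letter and its first position -/

/-- The largest letter of a word. -/
def maxLetter {n : ℕ} (e : Fin n → ℕ) : ℕ := Finset.univ.sup e

/-- The position, counted from `1`, of the first occurrence of the largest letter of a word. -/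
noncomputable def maxPos {n : ℕ} (e : Fin n → ℕ) : ℕ :=
  sInf {l | ∃ i : Fin n, (i : ℕ) + 1 = l ∧ e i = maxLetter e}

theorem exists_maxPos {n : ℕ} (hn : 0 < n) (e : Fin n → ℕ) :
    ∃ i : Fin n, (i : ℕ) + 1 = maxPos e ∧ e i = maxLetter e := by
  have : Nonempty (Fin n) := ⟨⟨0, hn⟩⟩
  obtain ⟨i, -, hi⟩ := Finset.exists_mem_eq_sup Finset.univ Finset.univ_nonempty e
  exact Nat.sInf_mem (s := {l | ∃ i : Fin n, (i : ℕ) + 1 = l ∧ e i = maxLetter e})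
    ⟨i + 1, i, rfl, hi.symm⟩

theorem mem_avoidersMaxPos_iff {n : ℕ} (hn : 0 < n) (m l : ℕ) (e : Fin n → ℕ) :
    e ∈ avoidersMaxPos n m l ↔ e ∈ avoiders n ∧ maxLetter e = m ∧ maxPos e = l := by
  refine and_congr_right fun _ => ⟨?_, ?_⟩
  · rintro ⟨hm, i, hil, him, hj⟩
    have h1 : maxLetter e = m :=
      le_antisymm (Finset.sup_le fun j _ => hm j) (him ▸ Finset.le_sup (Finset.mem_univ i))
    refine ⟨h1, ?_⟩
    obtain ⟨j, hjl, hje⟩ := exists_maxPos hn e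
    have h2 : maxPos e ≤ l := Nat.sInf_le ⟨i, hil, him.trans h1.symm⟩
    have h3 : ¬ j < i := fun h => hj j h (hje.trans h1)
    rw [Fin.lt_def] at h3
    omega
  · rintro ⟨rfl, rfl⟩
    obtain ⟨i, hil, hie⟩ := exists_maxPos hn e
    refine ⟨fun j => Finset.le_sup (Finset.mem_univ j), i, hil, hie, fun j hji hje => ?_⟩
    have : maxPos e ≤ j + 1 := Nat.sInf_le ⟨j, rfl, hje⟩
    rw [Fin.lt_def] at hji
    omega

/-- Only the zero word is not counted by one of the numbers `a n m l` with `m ≥ 1`. -/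
theorem sum_a_add_one (n : ℕ) (hn : 2 ≤ n) :
    ∑ l ∈ Finset.Icc 2 n, ∑ m ∈ Finset.Icc 1 (l - 1), a n m l + 1 = (avoiders n).ncard := by
  classical
  have h0 : (fun _ : Fin n => 0) ∈ (finite_avoiders n).toFinset := by
    rw [Set.Finite.mem_toFinset]
    exact zero_mem_avoiders n
  rw [Set.ncard_eq_toFinset_card _ (finite_avoiders n), ← Finset.card_erase_add_one h0,
    Finset.sum_sigma', Finset.card_eq_sum_card_fiberwise
      (f := fun e => (⟨maxPos e, maxLetter e⟩ : Σ _ : ℕ, ℕ))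
      (t := (Finset.Icc 2 n).sigma fun l => Finset.Icc 1 (l - 1))]
  · congr 1
    refine Finset.sum_congr rfl fun p hp => ?_
    obtain ⟨l, m⟩ := p
    rw [Finset.mem_sigma, Finset.mem_Icc, Finset.mem_Icc] at hp
    rw [a, Set.ncard_eq_toFinset_card _ (finite_avoidersMaxPos n m l)]
    congr 1
    ext e
    rw [Set.Finite.mem_toFinset, mem_avoidersMaxPos_iff (by omega), Finset.mem_filter,
      Finset.mem_erase, Set.Finite.mem_toFinset]
    simp only [Sigma.mk.injEq, heq_eq_eq]
    constructor
    · rintro ⟨he, hm, hl⟩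
      refine ⟨⟨?_, he⟩, hl, hm⟩
      rintro rfl
      have : maxLetter (fun _ : Fin n => 0) ≤ 0 := Finset.sup_le fun _ _ => le_rfl
      dsimp only at hp
      omega
    · rintro ⟨⟨-, he⟩, hl, hm⟩
      exact ⟨he, hm, hl⟩
  · intro e he
    rw [Finset.mem_coe, Finset.mem_erase, Set.Finite.mem_toFinset] at he
    rw [Finset.mem_coe, Finset.mem_sigma, Finset.mem_Icc, Finset.mem_Icc]
    obtain ⟨i, hi, hie⟩ := exists_maxPos (show 0 < n by omega) e
    have h1 : 1 ≤ maxLetter e := by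
      rw [Nat.one_le_iff_ne_zero]
      intro h
      refine he.1 (funext fun j => Nat.le_zero.1 (h ▸ Finset.le_sup (Finset.mem_univ j)))
    have h2 := he.2.1 i
    have h3 := i.isLt
    dsimp only
    omega

theorem aGenEval_one_one : aGenEval 1 1 = avoidersGF - geom := by
  ext n
  rw [aGenEval, coeff_map, aGen, coeff_mk, map_sub, avoidersGF, geom, coeff_mk, coeff_mk,
    Pi.one_apply]
  split_ifs with hn
  · rw [← sum_a_add_one n hn]
    simp [aPoly]
  · have h := avoidersGF_eq
    have hflat : coeff 0 (flat 0) = 1 := by simp [flat, series, count]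
    have hcoeff := congrArg (coeff n) h
    rw [avoidersGF, coeff_mk] at hcoeff
    rw [hcoeff, map_zero]
    interval_cases n
    · simp
    · rw [map_add, coeff_succ_X_mul, hflat]
      simp [coeff_one]

/-! ### Extraction of coefficients -/

theorem derivative_catX :
    PowerSeries.derivative ℚ catX = PowerSeries.mk fun n => (n.centralBinom : ℚ) := by
  ext n
  rw [PowerSeries.coeff_derivative, catX, coeff_succ_X_mul, coeff_map, coeff_mk,
    ← succ_mul_catalan_eq_centralBinom]
  simp [catalanSeries, mul_comm]

/-- `√(1 - 4x) ∑ (2n choose n) x^n = 1`, by differentiating `√(1 - 4x) ^ 2 = 1 - 4x`. -/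
theorem one_sub_two_catX_mul :
    (1 - 2 * catX) * PowerSeries.mk (fun n => (n.centralBinom : ℚ)) = 1 := by
  have h := congrArg (PowerSeries.derivative ℚ) catX_sub_sq
  rw [map_sub, pow_two, Derivation.leibniz, PowerSeries.derivative_X, derivative_catX,
    smul_eq_mul] at h
  linear_combination h

theorem mk_choose_eq :
    PowerSeries.mk (fun i => if i = 0 then (0 : ℚ) else ((2 * i).choose (i - 1) : ℚ)) =
      PowerSeries.mk (fun n => (n.centralBinom : ℚ)) -
        PowerSeries.map (Nat.castRingHom ℚ) catalanSeries := by
  ext i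
  rw [map_sub, coeff_mk, coeff_mk, coeff_map, catalanSeries, coeff_mk]
  cases i with
  | zero => simp
  | succ i =>
    rw [if_neg (Nat.succ_ne_zero i), Nat.add_sub_cancel]
    have h1 := Nat.choose_succ_right_eq (2 * (i + 1)) i
    rw [← Nat.centralBinom_eq_two_mul_choose, show 2 * (i + 1) - i = i + 2 by omega,
      ← succ_mul_catalan_eq_centralBinom] at h1
    rw [← succ_mul_catalan_eq_centralBinom]
    have h2 : (catalan (i + 1) : ℚ) * ((i + 1) * (i + 2)) = (2 * (i + 1)).choose i * (i + 2) := by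
      have := congrArg (Nat.cast : ℕ → ℚ) h1
      push_cast at this
      linear_combination this
    have h3 : (i + 2 : ℚ) ≠ 0 := by positivity
    apply mul_right_cancel₀ h3
    push_cast
    rw [sub_mul, ← h2]
    ring

theorem avoidersGF_eq_geom :
    avoidersGF - geom = geom * (X * PowerSeries.mk
      (fun i => if i = 0 then (0 : ℚ) else ((2 * i).choose (i - 1) : ℚ))) := by
  apply eq_of_mul_one_sub_X
  have h := avoidersGF_sub_geom_mul
  have hZ := one_sub_two_catX_mul
  have hc : X * PowerSeries.map (Nat.castRingHom ℚ) catalanSeries = catX := rfl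
  rw [mk_choose_eq]
  set Z := PowerSeries.mk (fun n => (n.centralBinom : ℚ))
  linear_combination Z * h - (avoidersGF - geom) * (1 - X) * hZ -
    X * (Z - PowerSeries.map (Nat.castRingHom ℚ) catalanSeries) * geom_mul + hc +
    Z * catX_sub_sq - catX * hZ

theorem ncard_avoiders (n : ℕ) (hn : 1 ≤ n) :
    (avoiders n).ncard = 1 + ∑ i ∈ Finset.Icc 1 (n - 1), Nat.choose (2 * i) (i - 1) := by
  obtain ⟨n, rfl⟩ : ∃ k, n = k + 1 := ⟨n - 1, by omega⟩
  have h := congrArg (coeff (n + 1)) avoidersGF_eq_geom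
  rw [map_sub, ← mul_assoc, mul_comm geom, mul_assoc, coeff_succ_X_mul, mul_comm geom,
    coeff_mul_range] at h
  simp only [avoidersGF, geom, coeff_mk, Pi.one_apply, mul_one] at h
  rw [Finset.sum_range_succ', if_pos rfl, add_zero] at h
  rw [Nat.add_sub_cancel, ← Finset.Ico_add_one_right_eq_Icc, Finset.sum_Ico_eq_sum_range]
  simp only [Nat.succ_ne_zero, if_false, Nat.add_sub_cancel, Nat.add_comm 1] at h ⊢
  have h2 : ((avoiders (n + 1)).ncard : ℚ) =
      ((∑ i ∈ Finset.range n, (2 * (i + 1)).choose i + 1 : ℕ) : ℚ) := by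
    push_cast
    linear_combination h
  exact_mod_cast h2

end InvSeq

theorem mainTheorem2 :
    InvSeq.aGenEval 1 1 =
        (X ^ 2 + X ^ 2 * InvSeq.sqrtOneSubFourX) *
          ((X - 1) * ((3 * X - 1) * InvSeq.sqrtOneSubFourX - 4 * X ^ 2 + 5 * X - 1))⁻¹ ∧
      ∀ n : ℕ, 1 ≤ n →
        (InvSeq.avoiders n).ncard =
          1 + ∑ i ∈ Finset.Icc 1 (n - 1), Nat.choose (2 * i) (i - 1) := by
  refine ⟨?_, InvSeq.ncard_avoiders⟩
  rw [PowerSeries.eq_mul_inv_iff_mul_eq (by rw [InvSeq.constantCoeff_denominator]; norm_num),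
    InvSeq.aGenEval_one_one, InvSeq.sqrtOneSubFourX_eq]
  have h := InvSeq.avoidersGF_sub_geom_mul
  have hx := InvSeq.catX_sub_sq
  have hden : (X - 1) * ((3 * X - 1) * (1 - 2 * InvSeq.catX) - 4 * X ^ 2 + 5 * X - 1) =
      (1 - X) * (1 - 2 * InvSeq.catX) * (2 * (1 - InvSeq.catX) ^ 3) := by
    rw [← hx]
    ring
  rw [hden]
  have hnum : X ^ 2 + X ^ 2 * (1 - 2 * InvSeq.catX) =
      InvSeq.catX ^ 2 * (2 * (1 - InvSeq.catX) ^ 3) := by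
    rw [← hx]
    ring
  rw [hnum]
  linear_combination 2 * (1 - InvSeq.catX) ^ 3 * h
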